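/- Let $n\ge 1$ and let $\langle C_\beta\mid\beta<\omega_n\rangle$ be a $C$-sequence on $\omega_n$ with $\mathrm{otp}(C_\beta)=\mathrm{cf}(\beta)$; that is, each $C_\beta$ is a closed cofinal subset of $\beta$ of order type $\mathrm{cf}(\beta)$. *Compound clubs.* For a tuple $\vec\gamma$ for which $C_{\vec\gamma}$ is defined and $\beta\in C_{\vec\gamma}$, let $\alpha=\mathrm{otp}(C_{\vec\gamma}\cap\beta)$, let $\pi:C_{\vec\gamma}\cap\beta\to\alpha$ be the order isomorphism, and let $C_{\beta\vec\gamma}=\pi^{-1}(C_\alpha)$. Call $(\gamma_0,\dots,\gamma_m)$ *nested* if $\gamma_i\in C_{\gamma_{i+1}\cdots\gamma_m}$ for all $i<m$, i.e. if $C_{\gamma_0\cdots\gamma_m}$ is defined; every $1$-tuple is nested. *Higher walks.* For a sign $s\in\{+1,-1\}$ and ordinals $\alpha_0\le\alpha_1\le\dots\le\alpha_n<\omega_n$ define the finite multiset $\mathrm{Tr}_n(s,\vec\alpha)$ of signed ordinals by the following (well-founded) recursion. Let $\vec\gamma=(\alpha_{j+1},\dots,\alpha_n)$, $0\le j<n$,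 be the longest nested proper tail of $\vec\alpha$. If $C_{\vec\gamma}\setminus\alpha_j=\varnothing$, then $\mathrm{Tr}_n(s,\vec\alpha)=\varnothing$. Otherwise let $\eta=\min(C_{\vec\gamma}\setminus\alpha_j)$ and $\vec b=(b_0,\dots,b_{n+1})=(\alpha_0,\dots,\alpha_j,\eta,\alpha_{j+1},\dots,\alpha_n)$, write $\vec b^{\,i}$ for $\vec b$ with its $i$-th coordinate omitted, and let $$\mathrm{Tr}_n(s,\vec\alpha)=\{(-1)^{j+1}s\cdot\eta\}\ \sqcup\bigsqcup_{\substack{1\le i\le n+1\\ i\ne j+1}}\mathrm{Tr}_n\big((-1)^{i+j}s,\ \vec b^{\,i}\big).$$ Let $\rho_2^n(\vec\alpha)$ be the number of negatively signed ordinals minus the number of positively signed ordinals in $\mathrm{Tr}_n(+1,\vec\alpha)$, counted with multiplicity. **Proposition.** For $\vec\beta=(\beta_0<\dots<\beta_{n-1})\in[\omega_n]^n$ let $\varphi_{\vec\beta}:\beta_0\to\mathbb Z$ be the fiber map $\varphi_{\vec\beta}(\alpha)=\rho_2^n(\alpha,\vec\beta)$. The family $\Phi_n=\{\varphi_{\vec\beta}\mid\vec\beta\in[\omega_n]^n\}$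 is $n$-coherent both modulo bounded functions and modulo locally constant functions. That is, for every $\vec\beta=(\beta_0<\dots<\beta_n)\in[\omega_n]^{n+1}$, the function $$\beta_0\to\mathbb Z,\qquad \alpha\mapsto\sum_{i=0}^n(-1)^i\varphi_{\vec\beta^i}(\alpha)$$ (where $\vec\beta^i$ omits the $i$-th coordinate) is bounded, and it is locally constant with respect to the order topology on $\beta_0$. -/

import Mathlib

open scoped Ordinal

universe u

namespace HigherWalks

/-- The order type of `S ∩ β`. -/
noncomputable def otp (S : Set Ordinal.{u}) (β : Ordinal.{u}) : Ordinal.{u} :=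
  typeLT {x : β.ToType // (x : Ordinal.{u}) ∈ S}

/-- `C` restricts to a `C`-sequence on `ε`: for every `β < ε`, the set `C β` is a closed cofinal
subset of `β` of the minimal possible order type `cf β`. -/
structure IsCSequence (C : Ordinal.{u} → Set Ordinal.{u}) (ε : Ordinal.{u}) : Prop where
  subset : ∀ β < ε, C β ⊆ Set.Iio β
  isClub : ∀ β < ε, IsClub {x : Set.Iio β | (x : Ordinal.{u}) ∈ C β}
  otp_eq : ∀ β < ε, otp (C β) β = β.cof.ord

/-- The compound sets `C_{γ₀ γ₁ … γₘ}`. The set `C_{β γ₀ … γₘ}` consists of those elements of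
`C_{γ₀ … γₘ} ∩ β` which the order isomorphism of `C_{γ₀ … γₘ} ∩ β` with its order type `α` sends
into `C α`. The recursion starts from the class of all ordinals, see `club_singleton`. -/
noncomputable def club (C : Ordinal.{u} → Set Ordinal.{u}) : List Ordinal.{u} → Set Ordinal.{u}
  | [] => Set.univ
  | β :: γ => {ξ | ξ ∈ club C γ ∧ ξ < β ∧ otp (club C γ) ξ ∈ C (otp (club C γ) β)}

theorem otp_univ (β : Ordinal.{u}) : otp Set.univ β = β := by
  have e : {x : β.ToType // (x : Ordinal.{u}) ∈ (Set.univ : Set Ordinal.{u})} ≃o β.ToType :=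
    { toEquiv := Equiv.subtypeUnivEquiv (fun _ => Set.mem_univ _)
      map_rel_iff' := Iff.rfl }
  unfold otp
  rw [Ordinal.type_eq.2 ⟨e.toRelIsoLT⟩, Ordinal.type_toType]

theorem club_singleton (C : Ordinal.{u} → Set Ordinal.{u}) (β : Ordinal.{u})
    (h : C β ⊆ Set.Iio β) : club C [β] = C β := by
  ext ξ
  simp only [club, Set.mem_univ, true_and, Set.mem_ofPred_eq, otp_univ]
  exact ⟨fun x => x.2, fun x => ⟨h x, x⟩⟩

/-- A tuple `(γ₀, …, γₘ)` is nested if `γᵢ ∈ C_{γᵢ₊₁ … γₘ}` for all `i < m`,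
i.e. if `C_{γ₀ … γₘ}` is meaningful. -/
def Nested (C : Ordinal.{u} → Set Ordinal.{u}) : List Ordinal.{u} → Prop
  | [] => True
  | β :: γ => β ∈ club C γ ∧ Nested C γ

/-- The index `j` for which `(αⱼ₊₁, …, αₙ)` is the longest nested proper tail of
`t = (α₀, …, αₙ)`. -/
noncomputable def pivot (C : Ordinal.{u} → Set Ordinal.{u}) (t : List Ordinal.{u}) : ℕ :=
  sInf {j | Nested C (t.drop (j + 1))}

/-- `C_{γ} \ αⱼ`, where `γ` is the longest nested proper tail `(αⱼ₊₁, …, αₙ)` of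
`t = (α₀, …, αₙ)`. -/
def candidates (C : Ordinal.{u} → Set Ordinal.{u}) (t : List Ordinal.{u}) : Set Ordinal.{u} :=
  {ξ | ξ ∈ club C (t.drop (pivot C t + 1)) ∧ ∀ a ∈ t[pivot C t]?, a ≤ ξ}

/-- The ordinal output of the walk at the input `t`. It is meaningful if `candidates C t` is
nonempty. -/
noncomputable def step (C : Ordinal.{u} → Set Ordinal.{u}) (t : List Ordinal.{u}) :
    Ordinal.{u} :=
  sInf (candidates C t)

/-- The tuple `(α₀, …, αⱼ, η, αⱼ₊₁, …, αₙ)`, where `η` is the output at `t = (α₀, …, αₙ)`. -/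
noncomputable def expand (C : Ordinal.{u} → Set Ordinal.{u}) (t : List Ordinal.{u}) :
    List Ordinal.{u} :=
  t.take (pivot C t + 1) ++ step C t :: t.drop (pivot C t + 1)

/-- The positions whose removal from `expand C t` produces the next inputs: all but
that of the least entry `α₀` and that of the new entry `η`. -/
noncomputable def faces (C : Ordinal.{u} → Set Ordinal.{u}) (t : List Ordinal.{u}) : Finset ℕ :=
  (Finset.Icc 1 t.length).erase (pivot C t + 1)

/-! The recursion defining the walk is well-founded. -/

section Termination

variable (C : Ordinal.{u} → Set Ordinal.{u})

open Classical in
/-- Weight of an entry `a` followed by the entries `g`. -/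
noncomputable def weight (a : Ordinal.{u}) (g : List Ordinal.{u}) : Ordinal.{u} :=
  if a ∈ club C g then a else Order.succ (sInf {ξ | ξ ∈ club C g ∧ a ≤ ξ})

/-- The weights of the entries of a tuple, the last entry first. -/
noncomputable def key : List Ordinal.{u} → List Ordinal.{u}
  | [] => []
  | a :: g => key g ++ [weight C a g]

/-- The order along which the recursion descends. -/
def Below (s t : List Ordinal.{u}) : Prop :=
  List.Shortlex (· < ·) (key C s) (key C t)

theorem below_wf : WellFounded (Below C) :=
  InvImage.wf (key C) (List.Shortlex.wf Ordinal.lt_wf)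

theorem length_key (t : List Ordinal.{u}) : (key C t).length = t.length := by
  induction t with
  | nil => rfl
  | cons a g ih => simp [key, ih]

theorem key_append (p g : List Ordinal.{u}) : ∃ q, key C (p ++ g) = key C g ++ q := by
  induction p with
  | nil => exact ⟨[], by simp⟩
  | cons a p ih =>
    obtain ⟨q, hq⟩ := ih
    exact ⟨q ++ [weight C a (p ++ g)], by simp [key, hq]⟩

theorem below_of_weight {p q g : List Ordinal.{u}} {x y : Ordinal.{u}}
    (hl : p.length = q.length) (h : weight C y g < weight C x g) :
    Below C (p ++ y :: g) (q ++ x :: g) := by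
  obtain ⟨r, hr⟩ := key_append C p (y :: g)
  obtain ⟨s, hs⟩ := key_append C q (x :: g)
  refine List.Shortlex.of_lex (by simp [length_key, hl]) ?_
  rw [hr, hs]
  simp only [key, List.append_assoc, List.singleton_append]
  exact List.Lex.append_left _ (List.Lex.rel h) _

theorem Nested.of_append {p g : List Ordinal.{u}} (h : Nested C (p ++ g)) : Nested C g := by
  induction p with
  | nil => exact h
  | cons a p ih => exact ih h.2

theorem nested_drop_pivot (t : List Ordinal.{u}) : Nested C (t.drop (pivot C t + 1)) := by
  refine Nat.sInf_mem (s := {j | Nested C (t.drop (j + 1))}) ⟨t.length, ?_⟩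
  have : t.drop (t.length + 1) = [] := List.drop_eq_nil_of_le (by omega)
  simp [this, Nested]

theorem not_nested_of_lt_pivot {t : List Ordinal.{u}} {i : ℕ} (h : i < pivot C t) :
    ¬ Nested C (t.drop (i + 1)) :=
  fun hn => Nat.notMem_of_lt_sInf (s := {j | Nested C (t.drop (j + 1))}) h hn

theorem below_eraseIdx {t : List Ordinal.{u}} (hne : (candidates C t).Nonempty) {i : ℕ}
    (hi : i ∈ faces C t) : Below C ((expand C t).eraseIdx i) t := by
  obtain ⟨hi1, hi2, hi3⟩ : i ≠ pivot C t + 1 ∧ 1 ≤ i ∧ i ≤ t.length := by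
    simpa [faces] using hi
  have hj : pivot C t < t.length := by
    by_contra hcon
    refine not_nested_of_lt_pivot C (t := t) (i := t.length - 1) (by omega) ?_
    rw [List.drop_eq_nil_of_le (by omega)]
    trivial
  have hg := nested_drop_pivot C t
  have hnot : ∀ i < pivot C t, ¬ Nested C (t.drop (i + 1)) :=
    fun i h => not_nested_of_lt_pivot C h
  have hη : step C t ∈ candidates C t := csInf_mem hne
  have hη1 : step C t ∈ club C (t.drop (pivot C t + 1)) := hη.1
  have hstep : step C t =
      sInf {ξ | ξ ∈ club C (t.drop (pivot C t + 1)) ∧ t[pivot C t] ≤ ξ} := by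
    simp [step, candidates, List.getElem?_eq_getElem hj]
  have ht : t = t.take (pivot C t) ++ t[pivot C t] :: t.drop (pivot C t + 1) := by
    simp
  have htake : t.take (pivot C t + 1) = t.take (pivot C t) ++ [t[pivot C t]] := by
    simp
  have hp : (t.take (pivot C t)).length = pivot C t := by
    rw [List.length_take]; omega
  have hdrop : t.drop (pivot C t) = t[pivot C t] :: t.drop (pivot C t + 1) := by
    simp
  unfold expand
  rw [htake]
  generalize t[pivot C t] = a at *
  generalize step C t = η at *
  generalize t.take (pivot C t) = p at *
  generalize t.drop (pivot C t + 1) = g at *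
  generalize pivot C t = j at *
  rcases Nat.lt_or_gt_of_ne hi1 with h | h
  · have hmem : a ∉ club C g := by
      intro hmem
      refine hnot (j - 1) (by omega) ?_
      rw [Nat.sub_add_cancel (by omega), hdrop]
      exact ⟨hmem, hg⟩
    rw [List.eraseIdx_append_of_lt_length (by simp; omega)]
    conv => arg 3; rw [ht]
    refine below_of_weight C ?_ ?_
    · rw [List.length_eraseIdx_of_lt (by simp; omega)]
      simp
    · simp only [weight, if_pos hη1, if_neg hmem, ← hstep]
      exact Order.lt_succ _
  · have hlen : t.length = j + (1 + g.length) := by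
      rw [ht, List.length_append, List.length_cons, hp]; omega
    have hcons : (p ++ [a]) ++ η :: g = (p ++ [a, η]) ++ g := by simp
    rw [hcons, List.eraseIdx_append_of_length_le (by simp; omega)]
    have hk : i - (p ++ [a, η]).length < g.length := by
      simp; omega
    generalize i - (p ++ [a, η]).length = k at *
    have hsplit : g = g.take k ++ g[k] :: g.drop (k + 1) := by simp
    rw [List.eraseIdx_eq_take_drop_succ]
    have hn2 : Nested C (g[k] :: g.drop (k + 1)) := by
      rw [hsplit] at hg
      simpa using hg.of_append
    generalize g[k] = x at *
    generalize g.drop (k + 1) = g2 at *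
    generalize g.take k = g1 at *
    subst hsplit
    rcases List.eq_nil_or_concat g1 with rfl | ⟨g3, y, rfl⟩
    · conv => arg 3; rw [ht]
      have e1 : p ++ [a, η] ++ ([] ++ g2) = (p ++ [a]) ++ η :: g2 := by simp
      have e2 : p ++ a :: ([] ++ x :: g2) = (p ++ [a]) ++ x :: g2 := by simp
      rw [e1, e2]
      refine below_of_weight C rfl ?_
      rw [weight, weight, if_pos hη1.1, if_pos hn2.1]
      exact hη1.2.1
    · conv => arg 3; rw [ht]
      have e1 : p ++ [a, η] ++ ((g3.concat y) ++ g2) = (p ++ a :: η :: g3) ++ y :: g2 := by simp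
      have e2 : p ++ a :: ((g3.concat y) ++ x :: g2) = (p ++ a :: (g3 ++ [y])) ++ x :: g2 := by
        simp
      have hy : y ∈ club C (x :: g2) := by
        have h3 : Nested C (g3 ++ (y :: x :: g2)) := by simpa using hg
        exact h3.of_append.1
      rw [e1, e2]
      refine below_of_weight C (by simp) ?_
      rw [weight, weight, if_pos hy.1, if_pos hn2.1]
      exact hy.2.1

end Termination

open Classical in
/-- The higher walk `Tr_n(s, α₀, …, αₙ)`, as a multiset of signed ordinals. -/
noncomputable def trace (C : Ordinal.{u} → Set Ordinal.{u}) (s : ℤˣ) (t : List Ordinal.{u}) :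
    Multiset (ℤˣ × Ordinal.{u}) :=
  if h : (candidates C t).Nonempty then
    {(s * (-1) ^ (pivot C t + 1), step C t)} +
      ∑ i : faces C t, trace C (s * (-1) ^ (pivot C t + i.1)) ((expand C t).eraseIdx i.1)
  else 0
termination_by (below_wf C).wrap t
decreasing_by exact below_eraseIdx C h i.2

/-- The number of negative minus the number of positive signed ordinals in
`Tr_n(+, α, β₀, …, βₙ₋₁)`. -/
noncomputable def rho (C : Ordinal.{u} → Set Ordinal.{u}) {n : ℕ} (α : Ordinal.{u})
    (β : Fin n → Ordinal.{u}) : ℤ :=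
  ((trace C 1 (α :: List.ofFn β)).countP fun x => x.1 = -1) -
    ((trace C 1 (α :: List.ofFn β)).countP fun x => x.1 = 1)

/-- `n`-coherence of the family of functions `φ β : β₀ → ℤ`, `β ∈ [ε]ⁿ`, modulo the functions
in `M`. Only the values `φ β α` with `α < β₀` matter. -/
def IsCoherentModulo (n : ℕ) (ε : Ordinal.{u}) (M : ∀ δ : Ordinal.{u}, Set (Set.Iio δ → ℤ))
    (φ : (Fin n → Ordinal.{u}) → Ordinal.{u} → ℤ) : Prop :=
  ∀ β : Fin (n + 1) → Ordinal.{u}, StrictMono β → (∀ i, β i < ε) →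
    (fun α : Set.Iio (β 0) => ∑ i : Fin (n + 1), (-1) ^ (i : ℕ) * φ (i.removeNth β) α) ∈ M (β 0)

/-- The modulus of bounded functions. -/
def boundedModulus (δ : Ordinal.{u}) : Set (Set.Iio δ → ℤ) :=
  {f | ∃ B : ℤ, ∀ α, |f α| ≤ B}

/-- The modulus of locally constant functions, in the order topology on `δ`. -/
def locallyConstantModulus (δ : Ordinal.{u}) : Set (Set.Iio δ → ℤ) :=
  {f | IsLocallyConstant f}

end HigherWalks

/-! Fix `α` and regard `ρ(α, ·)` as a cochain on the remaining coordinates; its coboundary at `β` is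
`defect C α β`, the alternating sum in question. Two facts govern it. The recursion of the walk is
itself a coboundary identity: whenever `α :: β` is the expansion of a walk input, the defect at `β`
is 1 (`defect_eq_one`). And a coboundary is a cocycle (`defect_cocycle`), so the defect at one face
of a tuple is determined by the defects at the other faces.

The core is `eventually_defect_const`: for `δ` at most every entry of `β`, the defect is constant
over all `α ≤ δ` near `δ`. The induction runs over `β` along the order `Below` of the walks. If `β`
is not nested and has an output, the other faces of its expansion lie below `β`. If it has no
output, `α :: β` is itself an expansion and the defect is 1. If `β = a :: g` is nested, put `η = min
(C_g \ δ)`. Each entry of a nested tuple lowers the order type by one aleph (`otp_club_lt`), so `C_g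
∩ δ` is finite and `η` is still `min (C_g \ α)` for `α ≤ δ` near `δ`. Hence the face `η :: g` of `η
:: a :: g` has defect 1, and when `η < a` the faces other than it and `β` lie below `β`.

Left neighbourhoods in the ordinals are neighbourhoods, which gives local constancy; compactness of
`[0, β₀]` gives boundedness. -/

namespace HigherWalks

/-! ### Order types of initial segments of sets of ordinals. -/

section OrderType

theorem otp_le_otp {S T : Set Ordinal.{u}} {β γ : Ordinal.{u}} (f : Ordinal.{u} → Ordinal.{u})
    (hf : ∀ x ∈ S, x < β → f x ∈ T ∧ f x < γ)
    (hmono : ∀ x ∈ S, ∀ y ∈ S, x < y → y < β → f x < f y) : otp S β ≤ otp T γ := by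
  let F : {x : β.ToType // (x : Ordinal.{u}) ∈ S} → {x : γ.ToType // (x : Ordinal.{u}) ∈ T} :=
    fun x => ⟨Ordinal.ToType.mk ⟨f x.1, (hf _ x.2 x.1.toOrd.2).2⟩, by
      simpa using (hf _ x.2 x.1.toOrd.2).1⟩
  have hF : StrictMono F := by
    intro x y hxy
    have h : (x.1 : Ordinal.{u}) < (y.1 : Ordinal.{u}) :=
      (Ordinal.ToType.mk.symm.lt_iff_lt (x := x.1) (y := y.1)).2 hxy
    have h' := hmono _ x.2 _ y.2 h y.1.toOrd.2
    rw [← Subtype.coe_lt_coe]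
    exact Ordinal.ToType.mk.lt_iff_lt.2 h'
  exact Ordinal.type_le_iff'.2 ⟨(OrderEmbedding.ofStrictMono F hF).ltEmbedding⟩

theorem otp_le_self (S : Set Ordinal.{u}) (β : Ordinal.{u}) : otp S β ≤ β := by
  conv_rhs => rw [← otp_univ β]
  exact otp_le_otp id (fun x _ h => ⟨trivial, h⟩) (fun _ _ _ _ h _ => h)

theorem otp_mono (S : Set Ordinal.{u}) {β γ : Ordinal.{u}} (h : β ≤ γ) : otp S β ≤ otp S γ :=
  otp_le_otp id (fun _ hx hlt => ⟨hx, hlt.trans_le h⟩) (fun _ _ _ _ h _ => h)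

theorem typein_eq_otp {S : Set Ordinal.{u}} {β : Ordinal.{u}}
    (y : {x : β.ToType // (x : Ordinal.{u}) ∈ S}) :
    Ordinal.typein (fun a b : {x : β.ToType // (x : Ordinal.{u}) ∈ S} => a < b) y =
      otp S (y.1 : Ordinal.{u}) := by
  rw [← Ordinal.type_subrel, otp]
  have hlt : ∀ a : {x : β.ToType // (x : Ordinal.{u}) ∈ S},
      a < y ↔ (a.1 : Ordinal.{u}) < (y.1 : Ordinal.{u}) := fun a =>
    (Ordinal.ToType.mk.symm.lt_iff_lt (x := a.1) (y := y.1)).symm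
  refine Ordinal.type_eq.2 ⟨⟨⟨fun a => ⟨Ordinal.ToType.mk ⟨a.1.1, (hlt _).1 a.2⟩, by
      simpa using a.1.2⟩, fun z => ⟨⟨Ordinal.ToType.mk ⟨z.1, lt_trans (Set.mem_Iio.1 z.1.toOrd.2) y.1.toOrd.2⟩, by
      simpa using z.2⟩, (hlt _).2 (by
      simp only [OrderIso.symm_apply_apply]; exact z.1.toOrd.2)⟩, fun a => ?_, fun z => ?_⟩, ?_⟩⟩
  · simp
  · simp
  · rintro ⟨a, ha⟩ ⟨b, hb⟩
    change Ordinal.ToType.mk _ < Ordinal.ToType.mk _ ↔ a < b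
    rw [Ordinal.ToType.mk.lt_iff_lt]
    exact Ordinal.ToType.mk.symm.lt_iff_lt (x := a.1) (y := b.1)

theorem otp_lt_otp {S : Set Ordinal.{u}} {x β : Ordinal.{u}} (hx : x ∈ S) (h : x < β) :
    otp S x < otp S β := by
  have := Ordinal.typein_lt_type
    (fun a b : {x : β.ToType // (x : Ordinal.{u}) ∈ S} => a < b)
    ⟨Ordinal.ToType.mk ⟨x, h⟩, by simpa using hx⟩
  rw [typein_eq_otp] at this
  change _ < otp S β at this
  simpa only [OrderIso.symm_apply_apply] using this

theorem exists_otp_eq {S : Set Ordinal.{u}} {o β : Ordinal.{u}} (h : o < otp S β) :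
    ∃ x ∈ S, x < β ∧ otp S x = o := by
  obtain ⟨y, hy⟩ := Ordinal.typein_surj _ h
  exact ⟨y.1, y.2, y.1.toOrd.2, (typein_eq_otp y).symm.trans hy⟩

theorem finite_of_otp_lt_omega0 {S : Set Ordinal.{u}} {β : Ordinal.{u}} (h : otp S β < ω) :
    {x | x ∈ S ∧ x < β}.Finite := by
  have hc : (otp S β).card < Cardinal.aleph0 := by
    rwa [← Cardinal.lt_ord, Cardinal.ord_aleph0]
  rw [otp, Ordinal.card_type, Cardinal.lt_aleph0_iff_finite] at hc
  refine (Set.finite_range fun y : {x : β.ToType // (x : Ordinal.{u}) ∈ S} =>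
    (y.1 : Ordinal.{u})).subset ?_
  rintro x ⟨hx, hlt⟩
  exact ⟨⟨Ordinal.ToType.mk ⟨x, hlt⟩, by simpa using hx⟩, by simp⟩

end OrderType

/-! ### Cofinality and order types of compound clubs. -/

section Clubs

variable {C : Ordinal.{u} → Set Ordinal.{u}}

/-- Cofinality of `C α` in `α = otp (C_g ∩ β)`, pulled back along the collapse of `C_g ∩ β`. -/
theorem exists_mem_club_cons {ε : Ordinal.{u}} (hC : IsCSequence C ε) {β x : Ordinal.{u}}
    {g : List Ordinal.{u}} (hβ : β < ε) (hx : x ∈ club C g) (hlt : x < β) :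
    ∃ ξ ∈ club C (β :: g), x ≤ ξ := by
  have ha : otp (club C g) β < ε := (otp_le_self _ _).trans_lt hβ
  obtain ⟨y, hy, hxy⟩ := (hC.isClub _ ha).isCofinal ⟨_, Set.mem_Iio.2 (otp_lt_otp hx hlt)⟩
  obtain ⟨z, hz, hzβ, hzy⟩ := exists_otp_eq y.2
  refine ⟨z, ⟨hz, hzβ, by rw [hzy]; exact hy⟩, ?_⟩
  by_contra! hcon
  have h1 := otp_lt_otp hz hcon
  rw [hzy] at h1
  exact absurd hxy (not_le.2 h1)

theorem otp_club_lt {n : ℕ} (hC : IsCSequence C (ω_ (n : Ordinal.{u}))) :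
    ∀ (g : List Ordinal.{u}) (k : ℕ), g.length + k = n → Nested C g →
      (∀ x ∈ g, x < ω_ (n : Ordinal.{u})) →
      ∀ η ∈ club C g, η < ω_ (n : Ordinal.{u}) → otp (club C g) η < ω_ (k : Ordinal.{u}) := by
  intro g
  induction g with
  | nil =>
    intro k hk _ _ η _ hη
    obtain rfl : k = n := by simpa using hk
    exact (otp_le_self _ _).trans_lt hη
  | cons β g ih =>
    intro k hk hg hlt η hη _
    have hβ := hlt β (by simp)
    have ha := ih (k + 1) (by simp at hk; omega) hg.2 (fun x hx => hlt x (by simp [hx])) β hg.1 hβ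
    have haε : otp (club C g) β < ω_ (n : Ordinal.{u}) := (otp_le_self _ _).trans_lt hβ
    -- The collapse of `C_g ∩ β` embeds `C_{βg} ∩ η` into a proper initial segment of `C α`, where
    -- `α = otp (C_g ∩ β)`.
    calc otp (club C (β :: g)) η
        ≤ otp (C (otp (club C g) β)) (otp (club C g) η) :=
          otp_le_otp (otp (club C g)) (fun x hx h => ⟨hx.2.2, otp_lt_otp hx.1 h⟩)
            (fun x hx y _ h _ => otp_lt_otp hx.1 h)
      _ < otp (C (otp (club C g) β)) (otp (club C g) β) :=
          otp_lt_otp hη.2.2 (otp_lt_otp hη.1 hη.2.1)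
      _ = (otp (club C g) β).cof.ord := hC.otp_eq _ haε
      _ ≤ ω_ (k : Ordinal.{u}) := by
          -- The cofinality is at most the cardinality, and `α < ω_{k+1}` has cardinality at most
          -- `ℵ_k`.
          rw [← Cardinal.ord_aleph, Cardinal.ord_le_ord]
          refine (Ordinal.cof_le_card _).trans ?_
          rw [← Cardinal.ord_aleph, Cardinal.lt_ord] at ha
          rw [← Order.lt_succ_iff, Cardinal.succ_aleph]
          simpa using ha

end Clubs

/-! ### The alternating coboundary on tuples. -/

section Coboundary

variable {α : Type*}

/-- The alternating sum of the values of `F` at the faces of a tuple. -/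
def coboundary : (List α → ℤ) → List α → ℤ
  | _, [] => 0
  | F, a :: l => F l - coboundary (fun l => F (a :: l)) l

theorem coboundary_sub (F G : List α → ℤ) (l : List α) :
    coboundary (fun l => F l - G l) l = coboundary F l - coboundary G l := by
  induction l generalizing F G with
  | nil => rfl
  | cons a l ih => simp only [coboundary, ih]; ring

theorem coboundary_coboundary (F : List α → ℤ) (l : List α) :
    coboundary (coboundary F) l = 0 := by
  induction l generalizing F with
  | nil => rfl
  | cons a l ih => simp only [coboundary, coboundary_sub, ih]; ring

theorem coboundary_eq_sum (F : List α → ℤ) (l : List α) :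
    coboundary F l = ∑ i ∈ Finset.range l.length, (-1) ^ i * F (l.eraseIdx i) := by
  induction l generalizing F with
  | nil => rfl
  | cons a l ih =>
    rw [List.length_cons, Finset.sum_range_succ', coboundary, ih]
    simp [pow_succ, Finset.sum_neg_distrib]
    ring

end Coboundary

/-! ### The walk recursion as a coboundary identity. -/

section Walks

variable {C : Ordinal.{u} → Set Ordinal.{u}}

/-- The hypothesis `hp` says that `g` is the longest nested proper tail, so the pivot is the
position of `a`. -/
theorem expand_eq {p g : List Ordinal.{u}} {a η : Ordinal.{u}} (hg : Nested C g)
    (hp : p = [] ∨ a ∉ club C g) (hη : IsLeast {ξ | ξ ∈ club C g ∧ a ≤ ξ} η) :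
    (candidates C (p ++ a :: g)).Nonempty ∧ expand C (p ++ a :: g) = p ++ a :: η :: g := by
  have hdrop : (p ++ a :: g).drop (p.length + 1) = g := by
    simp [List.drop_append, List.drop_eq_nil_of_le]
  have hpivot : pivot C (p ++ a :: g) = p.length := by
    refine le_antisymm (Nat.sInf_le ?_) ?_
    · simpa only [Set.mem_ofPred_eq, hdrop] using hg
    · by_contra! hlt
      have h := nested_drop_pivot C (p ++ a :: g)
      rw [List.drop_append_of_le_length (by omega)] at h
      rcases hp with rfl | hp
      · simp at hlt
      · exact hp h.of_append.1
  have hcand : candidates C (p ++ a :: g) = {ξ | ξ ∈ club C g ∧ a ≤ ξ} := by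
    unfold candidates
    rw [hpivot, hdrop]
    simp
  refine ⟨by rw [hcand]; exact ⟨η, hη.1⟩, ?_⟩
  rw [expand, step, hcand, hpivot, hη.csInf_eq, hdrop]
  simp [List.take_append, List.take_of_length_le]

/-- The number of negative minus the number of positive entries. -/
noncomputable def signedCount (m : Multiset (ℤˣ × Ordinal.{u})) : ℤ :=
  (m.countP fun x => x.1 = -1) - (m.countP fun x => x.1 = 1)

theorem signedCount_add (m m' : Multiset (ℤˣ × Ordinal.{u})) :
    signedCount (m + m') = signedCount m + signedCount m' := by
  simp only [signedCount, Multiset.countP_add]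
  push_cast
  ring

theorem signedCount_sum {ι : Type*} (s : Finset ι) (m : ι → Multiset (ℤˣ × Ordinal.{u})) :
    signedCount (∑ i ∈ s, m i) = ∑ i ∈ s, signedCount (m i) :=
  map_sum (AddMonoidHom.mk' signedCount signedCount_add) m s

theorem signedCount_singleton (s : ℤˣ) (η : Ordinal.{u}) :
    signedCount {(s, η)} = -(s : ℤ) := by
  have h1 : (1 : ℤˣ) ≠ -1 := by decide
  rcases Int.units_eq_one_or s with rfl | rfl
  · simp [signedCount, ← Multiset.cons_zero, h1]
  · simp [signedCount, ← Multiset.cons_zero, h1.symm]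

theorem signedCount_trace_of_nonempty (s : ℤˣ) {t : List Ordinal.{u}}
    (h : (candidates C t).Nonempty) :
    signedCount (trace C s t) = -(s * (-1) ^ (pivot C t + 1) : ℤ) +
      ∑ i ∈ faces C t,
        signedCount (trace C (s * (-1) ^ (pivot C t + i)) ((expand C t).eraseIdx i)) := by
  rw [trace, dif_pos h, signedCount_add, signedCount_singleton, signedCount_sum,
    Finset.sum_coe_sort (faces C t) fun i =>
      signedCount (trace C (s * (-1) ^ (pivot C t + i)) ((expand C t).eraseIdx i))]
  simp

/-- Signs propagate multiplicatively through the recursion, so every subwalk can be normalised to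
sign `+1`. -/
theorem signedCount_trace (s : ℤˣ) (t : List Ordinal.{u}) :
    signedCount (trace C s t) = s * signedCount (trace C 1 t) := by
  induction t using (below_wf C).induction generalizing s with
  | _ t ih =>
    by_cases h : (candidates C t).Nonempty
    · rw [signedCount_trace_of_nonempty s h, signedCount_trace_of_nonempty 1 h, mul_add,
        Finset.mul_sum]
      congr 1
      · simp
      · refine Finset.sum_congr rfl fun i hi => ?_
        have hb := below_eraseIdx C h hi
        rw [ih _ hb, ih _ hb (1 * _)]
        push_cast
        ring
    · rw [trace, dif_neg h, trace, dif_neg h]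
      simp [signedCount]

/-- The alternating sum of the values of the fiber maps at `α` over the faces of `β`. -/
noncomputable def defect (C : Ordinal.{u} → Set Ordinal.{u}) (α : Ordinal.{u}) :
    List Ordinal.{u} → ℤ :=
  coboundary fun l => signedCount (trace C 1 (α :: l))

theorem expand_eraseIdx {t : List Ordinal.{u}} (ht : pivot C t < t.length) :
    (expand C t).eraseIdx (pivot C t + 1) = t := by
  have hl : (t.take (pivot C t + 1)).length = pivot C t + 1 := by
    rw [List.length_take]; omega
  rw [expand, List.eraseIdx_append_of_length_le hl.le, hl]
  simp

theorem pivot_lt_length {t : List Ordinal.{u}} (ht : t ≠ []) : pivot C t < t.length := by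
  have h0 := List.length_pos_iff.2 ht
  by_contra hcon
  refine not_nested_of_lt_pivot C (t := t) (i := t.length - 1) (by omega) ?_
  rw [List.drop_eq_nil_of_le (by omega)]
  trivial

theorem defect_eq_one {t β : List Ordinal.{u}} {α : Ordinal.{u}}
    (h : (candidates C t).Nonempty) (ht : t ≠ []) (he : expand C t = α :: β) :
    defect C α β = 1 := by
  have hj := pivot_lt_length (C := C) ht
  have hlen : β.length = t.length := by
    have := congrArg List.length he
    simp [expand] at this
    omega
  set F : ℕ → ℤ := fun i => (-1) ^ i * signedCount (trace C 1 ((expand C t).eraseIdx i)) with hF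
  have hmem : pivot C t + 1 ∈ Finset.Icc 1 t.length := by simp; omega
  -- The position `pivot C t + 1` omitted from `faces` gives `t` back. Unfolding the walk at `t`
  -- cancels the remaining faces and leaves only the contribution of the output.
  have hsum : ∑ i ∈ Finset.Icc 1 t.length, F i = -1 := by
    rw [← Finset.add_sum_erase _ _ hmem]
    have h1 : F (pivot C t + 1) = (-1) ^ (pivot C t + 1) * signedCount (trace C 1 t) := by
      simp only [hF]; rw [expand_eraseIdx hj]
    rw [h1, signedCount_trace_of_nonempty 1 h, mul_add, Finset.mul_sum]
    have h2 : ∀ i ∈ faces C t, (-1) ^ (pivot C t + 1) *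
        signedCount (trace C (1 * (-1) ^ (pivot C t + i)) ((expand C t).eraseIdx i)) = -F i := by
      intro i _
      rw [signedCount_trace]
      simp only [hF]
      push_cast
      have : ((-1 : ℤ) ^ pivot C t) * (-1) ^ pivot C t = 1 := by
        rw [← mul_pow]; simp
      rw [pow_add, pow_add]
      linear_combination (-(-1 : ℤ) ^ i *
        signedCount (trace C 1 ((expand C t).eraseIdx i))) * this
    rw [Finset.sum_congr rfl h2, Finset.sum_neg_distrib, ← faces]
    have : ((-1 : ℤ) ^ (pivot C t + 1)) * (-1) ^ (pivot C t + 1) = 1 := by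
      rw [← mul_pow]; simp
    push_cast
    linear_combination -this
  rw [defect, coboundary_eq_sum, hlen]
  -- Deleting position `i + 1` of `α :: β` deletes position `i` of `β`; the shift turns the sum `-1`
  -- into the defect `1`.
  have hshift : ∑ i ∈ Finset.Icc 1 t.length, F i = ∑ i ∈ Finset.range t.length, F (i + 1) := by
    rw [Finset.range_eq_Ico, Finset.sum_Ico_add' F 0 t.length 1]
    rfl
  rw [hshift] at hsum
  have h3 : ∀ i ∈ Finset.range t.length,
      (-1) ^ i * signedCount (trace C 1 (α :: β.eraseIdx i)) = -F (i + 1) := by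
    intro i _
    simp only [hF, he, List.eraseIdx_cons_succ, pow_succ]
    ring
  rw [Finset.sum_congr rfl h3, Finset.sum_neg_distrib, hsum, neg_neg]

theorem defect_cocycle (α : Ordinal.{u}) (e : List Ordinal.{u}) :
    ∑ i ∈ Finset.range e.length, (-1) ^ i * defect C α (e.eraseIdx i) = 0 := by
  rw [← coboundary_eq_sum]
  exact coboundary_coboundary _ _

end Walks

/-! ### Eventual constancy of the defect. -/

section Coherence

open Filter Topology

variable {C : Ordinal.{u} → Set Ordinal.{u}}

theorem exists_pivot_decomposition (C : Ordinal.{u} → Set Ordinal.{u}) {l : List Ordinal.{u}}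
    (hl : l ≠ []) :
    ∃ p a g, l = p ++ a :: g ∧ Nested C g ∧ (p = [] ∨ a ∉ club C g) := by
  induction l with
  | nil => exact absurd rfl hl
  | cons x l ih =>
    rcases eq_or_ne l [] with rfl | hne
    · exact ⟨[], x, [], rfl, trivial, Or.inl rfl⟩
    · obtain ⟨p, a, g, rfl, hg, hp⟩ := ih hne
      by_cases ha : a ∈ club C g
      · obtain rfl : p = [] := hp.resolve_right (not_not.2 ha)
        exact ⟨[], x, a :: g, rfl, ⟨ha, hg⟩, Or.inl rfl⟩
      · exact ⟨x :: p, a, g, rfl, hg, Or.inr ha⟩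

theorem exists_isLeast {s : Set Ordinal.{u}} (h : s.Nonempty) : ∃ η, IsLeast s η :=
  ⟨sInf s, csInf_mem h, fun _ hx => csInf_le' hx⟩

/-- The entry just before the deleted one moves into its place; by nestedness it is smaller, and
both carry themselves as weight. -/
theorem below_cons_eraseIdx {a η : Ordinal.{u}} {g : List Ordinal.{u}} (hg : Nested C (a :: g))
    {i : ℕ} (hi : i < g.length) : Below C (η :: a :: g.eraseIdx i) (a :: g) := by
  have hsplit : g = g.take i ++ g[i] :: g.drop (i + 1) := by simp
  rw [List.eraseIdx_eq_take_drop_succ]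
  generalize g[i] = x at *
  generalize g.drop (i + 1) = g₂ at *
  generalize g.take i = g₁ at *
  subst hsplit
  obtain ⟨q, y, hq⟩ : ∃ q y, a :: g₁ = q ++ [y] :=
    (List.eq_nil_or_concat (a :: g₁)).resolve_left (by simp) |>.imp fun _ h =>
      h.imp fun _ h => by simpa using h
  have e₁ : η :: a :: (g₁ ++ g₂) = (η :: q) ++ y :: g₂ := by
    rw [← List.cons_append, hq]; simp
  have e₂ : a :: (g₁ ++ x :: g₂) = (q ++ [y]) ++ x :: g₂ := by
    rw [← List.cons_append, hq]
  rw [e₂] at hg ⊢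
  rw [e₁]
  have hy : Nested C (y :: x :: g₂) := by
    refine Nested.of_append C (p := q) ?_
    simpa using hg
  refine below_of_weight C (by simp) ?_
  rw [weight, weight, if_pos hy.1.1, if_pos hy.2.1]
  exact hy.1.2.1

/-- Deleting the head moves `η`, of weight `η`, into the place of `a`, whose weight is `succ η`
because `a ∉ C_g`. This is the one face that the walk itself does not visit. -/
theorem below_tail {p g : List Ordinal.{u}} {a η : Ordinal.{u}} (ha : a ∉ club C g)
    (hη : IsLeast {ξ | ξ ∈ club C g ∧ a ≤ ξ} η) :
    Below C ((p ++ a :: η :: g).eraseIdx 0) (p ++ a :: g) := by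
  have e : (p ++ a :: η :: g).eraseIdx 0 = (p ++ [a]).tail ++ η :: g := by
    cases p <;> simp
  rw [e]
  refine below_of_weight C (by simp) ?_
  rw [weight, weight, if_pos hη.1.1, if_neg ha, hη.csInf_eq]
  exact Order.lt_succ _

theorem eventually_lt_of_finite {S : Set Ordinal.{u}} {δ : Ordinal.{u}}
    (h : {x | x ∈ S ∧ x < δ}.Finite) : ∀ᶠ α in 𝓝[≤] δ, ∀ x ∈ S, x < δ → x < α := by
  have := (eventually_all_finite h).2 fun x hx =>
    (Ioi_mem_nhds hx.2 : Set.Ioi x ∈ 𝓝 δ)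
  filter_upwards [mem_nhdsWithin_of_mem_nhds this] with α hα x hx hlt using hα x ⟨hx, hlt⟩

/-- The cocycle identity, solved for the `k`-th face. -/
theorem eventually_defect_const_of_faces {δ : Ordinal.{u}} {e : List Ordinal.{u}} {k : ℕ}
    (hk : k < e.length)
    (h : ∀ i < e.length, i ≠ k → ∃ c, ∀ᶠ α in 𝓝[≤] δ, defect C α (e.eraseIdx i) = c) :
    ∃ c, ∀ᶠ α in 𝓝[≤] δ, defect C α (e.eraseIdx k) = c := by
  choose! c hc using h
  refine ⟨-(-1) ^ k * ∑ i ∈ (Finset.range e.length).erase k, (-1) ^ i * c i, ?_⟩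
  have hall : ∀ᶠ α in 𝓝[≤] δ, ∀ i ∈ (Finset.range e.length).erase k,
      defect C α (e.eraseIdx i) = c i := by
    rw [eventually_all_finset]
    intro i hi
    rw [Finset.mem_erase, Finset.mem_range] at hi
    exact hc i hi.2 hi.1
  filter_upwards [hall] with α hα
  have h0 := defect_cocycle (C := C) α e
  rw [← Finset.add_sum_erase _ _ (Finset.mem_range.2 hk),
    Finset.sum_congr rfl fun i hi => by rw [hα i hi]] at h0
  have : ((-1 : ℤ) ^ k) * (-1) ^ k = 1 := by rw [← mul_pow]; simp
  linear_combination (-1) ^ k * h0 - defect C α (e.eraseIdx k) * this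

theorem eventually_defect_eq_one {n : ℕ} (hC : IsCSequence C (ω_ (n : Ordinal.{u})))
    {δ η : Ordinal.{u}} {g : List Ordinal.{u}} (hlen : g.length = n) (hg : Nested C g)
    (hlt : ∀ x ∈ g, x < ω_ (n : Ordinal.{u})) (hηn : η < ω_ (n : Ordinal.{u}))
    (hη : IsLeast {ξ | ξ ∈ club C g ∧ δ ≤ ξ} η) :
    ∀ᶠ α in 𝓝[≤] δ, defect C α (η :: g) = 1 := by
  have hotp : otp (club C g) δ < ω := by
    refine (otp_mono _ hη.1.2).trans_lt ?_
    -- A nested tuple of length `n` uses up all `n` alephs, leaving `ω_ 0 = ω`.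
    simpa using otp_club_lt hC g 0 (by simpa using hlen) hg hlt η hη.1.1 hηn
  filter_upwards [eventually_lt_of_finite (finite_of_otp_lt_omega0 hotp),
    self_mem_nhdsWithin] with α hα hαδ
  have hleast : IsLeast {ξ | ξ ∈ club C g ∧ α ≤ ξ} η := by
    refine ⟨⟨hη.1.1, le_trans hαδ hη.1.2⟩, fun ξ hξ => hη.2 ⟨hξ.1, ?_⟩⟩
    by_contra! hcon
    exact absurd (hα ξ hξ.1 hcon) (not_lt.2 hξ.2)
  obtain ⟨h1, h2⟩ := expand_eq (p := []) hg (Or.inl rfl) hleast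
  exact defect_eq_one h1 (by simp) h2

theorem eventually_defect_const {n : ℕ} (hC : IsCSequence C (ω_ (n : Ordinal.{u})))
    (δ : Ordinal.{u}) (β : List Ordinal.{u}) :
    β.length = n + 1 → β.Pairwise (· < ·) →
      (∀ x ∈ β, δ ≤ x ∧ x < ω_ (n : Ordinal.{u})) →
      ∃ c, ∀ᶠ α in 𝓝[≤] δ, defect C α β = c := by
  induction β using (below_wf C).induction with
  | _ β ih =>
  intro hlen hsort hbd
  obtain ⟨p, a, g, rfl, hg, hp⟩ := exists_pivot_decomposition C (l := β) (by
    rintro rfl; simp at hlen)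
  by_cases ha : a ∈ club C g
  · obtain rfl : p = [] := hp.resolve_right (not_not.2 ha)
    rw [List.nil_append] at *
    have hgn : g.length = n := by simpa using hlen
    obtain ⟨haδ, han⟩ := hbd a (by simp)
    obtain ⟨η, hη⟩ := exists_isLeast (s := {ξ | ξ ∈ club C g ∧ δ ≤ ξ}) ⟨a, ha, haδ⟩
    have hηa : η ≤ a := hη.2 ⟨ha, haδ⟩
    have hone := eventually_defect_eq_one hC hgn hg
      (fun x hx => (hbd x (by simp [hx])).2) (hηa.trans_lt han) hη
    rcases hηa.eq_or_lt with rfl | hηa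
    · exact ⟨1, hone⟩
    have hsorte : (η :: a :: g).Pairwise (· < ·) := by
      refine List.pairwise_cons.2 ⟨fun x hx => ?_, hsort⟩
      rcases List.mem_cons.1 hx with rfl | hx
      · exact hηa
      · exact hηa.trans ((List.pairwise_cons.1 hsort).1 x hx)
    -- Face 0 is the tuple in question, face 1 is `η :: g` with defect 1, and the rest come from the
    -- induction hypothesis.
    refine eventually_defect_const_of_faces (e := η :: a :: g) (k := 0) (by simp) ?_
    rintro (_ | _ | i) hi hik
    · exact absurd rfl hik
    · exact ⟨1, hone⟩
    · have hi' : i < g.length := by simpa using hi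
      simp only [List.eraseIdx_cons_succ]
      refine ih _ (below_cons_eraseIdx ⟨ha, hg⟩ hi') ?_ ?_ ?_
      · simp [List.length_eraseIdx, hi']; omega
      · exact hsorte.sublist (((List.eraseIdx_sublist g i).cons_cons a).cons_cons η)
      · intro x hx
        rcases List.mem_cons.1 hx with rfl | hx
        · exact ⟨hη.1.2, hηa.trans han⟩
        · exact hbd x (((List.eraseIdx_sublist g i).cons_cons a).subset hx)
  · obtain ⟨hsp, hsa, hspa⟩ := List.pairwise_append.1 hsort
    rw [List.pairwise_cons] at hsa
    obtain ⟨haδ, han⟩ := hbd a (by simp)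
    by_cases hne : {ξ | ξ ∈ club C g ∧ a ≤ ξ}.Nonempty
    · obtain ⟨η, hη⟩ := exists_isLeast hne
      have haη : a < η := lt_of_le_of_ne hη.1.2 fun h => ha (h ▸ hη.1.1)
      have hηg : ∀ x ∈ g, η < x := by
        cases g with
        | nil => simp
        | cons b h =>
          have hb : η < b := hη.1.1.2.1
          intro x hx
          rcases List.mem_cons.1 hx with rfl | hx
          · exact hb
          · exact hb.trans ((List.pairwise_cons.1 hsa.2).1 x hx)
      have hηn : η < ω_ (n : Ordinal.{u}) := by
        cases g with
        | nil => exact absurd trivial ha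
        | cons b h => exact (hηg b (by simp)).trans (hbd b (by simp)).2
      have hsorte : (p ++ a :: η :: g).Pairwise (· < ·) := by
        refine List.pairwise_append.2 ⟨hsp, ?_, fun x hx y hy => ?_⟩
        · refine List.pairwise_cons.2 ⟨fun x hx => ?_, List.pairwise_cons.2 ⟨hηg, hsa.2⟩⟩
          rcases List.mem_cons.1 hx with rfl | hx
          · exact haη
          · exact hsa.1 x hx
        · have hxa := hspa x hx a (by simp)
          simp only [List.mem_cons] at hy
          rcases hy with rfl | rfl | hy
          · exact hxa
          · exact hxa.trans haη
          · exact hspa x hx y (by simp [hy])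
      have hbde : ∀ x ∈ p ++ a :: η :: g, δ ≤ x ∧ x < ω_ (n : Ordinal.{u}) := by
        intro x hx
        by_cases hxη : x = η
        · exact hxη ▸ ⟨haδ.trans haη.le, hηn⟩
        · exact hbd x (by simpa [hxη] using hx)
      obtain ⟨hcand, hexp⟩ := expand_eq hg hp hη
      have hpiv := pivot_lt_length (C := C) (t := p ++ a :: g) (by simp)
      have herase := expand_eraseIdx hpiv
      rw [hexp] at herase
      have hle : (p ++ a :: η :: g).length = (p ++ a :: g).length + 1 := by simp; omega
      rw [← herase]
      refine eventually_defect_const_of_faces (by omega) fun i hi hik => ?_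
      refine ih _ ?_ ?_ ?_ ?_
      · rcases Nat.eq_zero_or_pos i with rfl | hi0
        · exact below_tail ha hη
        · rw [← hexp]
          refine below_eraseIdx C hcand ?_
          simp only [faces, Finset.mem_erase, Finset.mem_Icc]
          omega
      · rw [List.length_eraseIdx_of_lt hi]; omega
      · exact hsorte.sublist (List.eraseIdx_sublist _ _)
      · exact fun x hx => hbde x ((List.eraseIdx_sublist _ _).subset hx)
    · have hlt : ∀ ξ ∈ club C g, ξ < a := fun ξ hξ => by
        by_contra! hcon
        exact hne ⟨ξ, hξ, hcon⟩
      cases g with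
      | nil => exact absurd trivial ha
      | cons b h =>
        have hab : a < b := hsa.1 b (by simp)
        -- `C_{bh}` lies below `a` and is cofinal in `C_h ∩ b`, so `C_h` has no element in `[a, b)`.
        have hgap : ∀ ξ ∈ club C h, ξ < b → ξ < a := fun ξ hξ hξb => by
          obtain ⟨ζ, hζ, hle⟩ := exists_mem_club_cons hC (hbd b (by simp)).2 hξ hξb
          exact hle.trans_lt (hlt ζ hζ)
        have hleast : IsLeast {ξ | ξ ∈ club C h ∧ a ≤ ξ} b := by
          refine ⟨⟨hg.1, hab.le⟩, fun ξ hξ => ?_⟩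
          by_contra! hcon
          exact absurd (hgap ξ hξ.1 hcon) (not_lt.2 hξ.2)
        refine ⟨1, Eventually.of_forall fun α => ?_⟩
        -- Thus `b` is the output at `α :: p ++ a :: h`, and inserting it yields `α` followed by the
        -- given tuple.
        obtain ⟨h1, h2⟩ := expand_eq (p := α :: p) hg.2
          (Or.inr fun hah => lt_irrefl a (hgap a hah hab)) hleast
        exact defect_eq_one h1 (by simp) h2

/-! ### From eventual constancy to the two moduli. -/

theorem eraseIdx_ofFn {α : Type*} {n : ℕ} (f : Fin (n + 1) → α) (i : Fin (n + 1)) :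
    (List.ofFn f).eraseIdx i = List.ofFn (i.removeNth f) := by
  refine List.ext_getElem ?_ fun k h₁ h₂ => ?_
  · rw [List.length_eraseIdx_of_lt (by rw [List.length_ofFn]; exact i.2)]; simp
  · rw [List.getElem_eraseIdx]
    simp only [List.getElem_ofFn, Fin.removeNth, Fin.succAbove, Fin.lt_def, Fin.val_castSucc]
    split_ifs <;> rfl

theorem sum_rho_eq_defect {n : ℕ} (α : Ordinal.{u}) (β : Fin (n + 1) → Ordinal.{u}) :
    ∑ i : Fin (n + 1), (-1) ^ (i : ℕ) * rho C α (i.removeNth β) = defect C α (List.ofFn β) := by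
  rw [defect, coboundary_eq_sum, List.length_ofFn,
    ← Fin.sum_univ_eq_sum_range (fun i => (-1) ^ i *
      signedCount (trace C 1 (α :: (List.ofFn β).eraseIdx i)))]
  simp only [eraseIdx_ofFn]
  rfl

/-- The compactness of closed initial segments of the ordinals. -/
theorem exists_bound_of_eventually_const {f : Ordinal.{u} → ℤ} {β : Ordinal.{u}}
    (h : ∀ δ ≤ β, ∃ c, ∀ᶠ α in 𝓝[≤] δ, f α = c) : ∃ B : ℤ, ∀ α ≤ β, |f α| ≤ B := by
  induction β using WellFoundedLT.induction with
  | _ β ih =>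
    obtain ⟨c, hc⟩ := h β le_rfl
    rcases eq_or_ne β 0 with rfl | hβ
    · refine ⟨|f 0|, fun α hα => ?_⟩
      rw [nonpos_iff_eq_zero.1 hα]
    -- The function is constant on some `(ξ, β]`; the induction hypothesis bounds it on `[0, ξ]`.
    · obtain ⟨ξ, hξ, hsub⟩ := (mem_nhdsLE_iff_exists_Ioc_subset' (pos_iff_ne_zero.2 hβ)).1 hc
      obtain ⟨B, hB⟩ := ih ξ hξ fun δ hδ => h δ (hδ.trans hξ.le)
      refine ⟨max B |c|, fun α hα => ?_⟩
      rcases le_or_gt α ξ with hle | hlt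
      · exact (hB α hle).trans (le_max_left _ _)
      · rw [show f α = c from hsub ⟨hlt, hα⟩]
        exact le_max_right _ _

theorem nhdsLE_eq_nhds (δ : Ordinal.{u}) : 𝓝[≤] δ = 𝓝 δ := by
  have : Set.Iic δ ∈ 𝓝 δ := by
    rw [← Order.Iio_succ]
    exact Iio_mem_nhds (Order.lt_succ δ)
  exact nhdsWithin_eq_nhds.2 this

theorem eventually_sum_rho_const {n : ℕ} (hC : IsCSequence C (ω_ (n : Ordinal.{u})))
    {β : Fin (n + 1) → Ordinal.{u}} (hβ : StrictMono β)
    (hlt : ∀ i, β i < ω_ (n : Ordinal.{u})) {δ : Ordinal.{u}} (hδ : δ ≤ β 0) :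
    ∃ c, ∀ᶠ α in 𝓝[≤] δ,
      ∑ i : Fin (n + 1), (-1) ^ (i : ℕ) * rho C α (i.removeNth β) = c := by
  simp only [sum_rho_eq_defect]
  refine eventually_defect_const hC δ _ (by simp) (List.pairwise_ofFn.2 fun _ _ h => hβ h) ?_
  intro x hx
  obtain ⟨i, rfl⟩ := List.mem_ofFn.1 hx
  exact ⟨hδ.trans (hβ.monotone (Fin.zero_le i)), hlt i⟩

end Coherence

end HigherWalks

theorem mainTheorem11 (n : ℕ) (hn : 0 < n) (C : Ordinal.{u} → Set Ordinal.{u})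
    (hC : HigherWalks.IsCSequence C (ω_ (n : Ordinal.{u}))) :
    HigherWalks.IsCoherentModulo n (ω_ (n : Ordinal.{u})) HigherWalks.boundedModulus
        (fun β α => HigherWalks.rho C α β) ∧
      HigherWalks.IsCoherentModulo n (ω_ (n : Ordinal.{u})) HigherWalks.locallyConstantModulus
        (fun β α => HigherWalks.rho C α β) := by
  refine ⟨fun β hβ hlt => ?_, fun β hβ hlt => ?_⟩
  · obtain ⟨B, hB⟩ := HigherWalks.exists_bound_of_eventually_const fun δ hδ =>
      HigherWalks.eventually_sum_rho_const hC hβ hlt hδ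
    exact ⟨B, fun α => hB α (le_of_lt α.2)⟩
  · refine (IsLocallyConstant.iff_eventually_eq _).2 fun δ => ?_
    obtain ⟨c, hc⟩ := HigherWalks.eventually_sum_rho_const hC hβ hlt (le_of_lt δ.2)
    rw [HigherWalks.nhdsLE_eq_nhds] at hc
    have hδ := hc.self_of_nhds
    filter_upwards [continuous_subtype_val.continuousAt.eventually hc] with α hα
    exact hα.trans hδ.symm
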